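/- **Setting.** Let $q\ge 1$ and let $\{\boldsymbol X_t\}_{t\in\mathbb Z}$ be an $\mathbb R^q$-valued weakly stationary process on a probability space $(\Omega,\mathcal F,\mathbb P)$ with $$\operatorname{diag}_{k}\{(1-\mathcal B)^{d_k^0}\}\,(\boldsymbol X_t-\mathbb E\boldsymbol X_t)=\boldsymbol Y_t ,\qquad t\in\mathbb Z,$$ where $\boldsymbol d_0=(d_1^0,\dots,d_q^0)\in(-\tfrac12,\tfrac12)^q$, $\mathcal B$ is the backward shift, $(1-\mathcal B)^{d}=\sum_{j\ge0}(-1)^j\binom{d}{j}\mathcal B^j$ converges in mean square, and $\boldsymbol Y$ is weakly stationary with spectral density matrix $f_{\boldsymbol Y}$ bounded and bounded away from zero (i.e. $c\,\mathrm I_q\le f_{\boldsymbol Y}\le C\,\mathrm I_q$ a.e. on $(-\pi,\pi]$ for some $0<c\le C<\infty$) and $f_{\boldsymbol Y}(\lambda)\to G_0$ as $\lambda\to0^+$, for a real symmetric positive definite matrix $G_0=(G_0^{rs})$. Let $f$ be the spectral density matrix of $\boldsymbol X$: $\mathbb E[(\boldsymbol X_t-\mathbb E\boldsymbol X_t)(\boldsymbol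 X_{t+h}-\mathbb E\boldsymbol X_{t+h})']=\int_{-\pi}^{\pi}e^{ih\lambda}f(\lambda)\,d\lambda$ for $h\in\mathbb Z$. Assume, with $\|\cdot\|_\infty$ the sup-norm: * **A1.** For all $r,s$, $f_{rs}(\lambda)=e^{i\pi(d_r^0-d_s^0)/2}G_0^{rs}\lambda^{-d_r^0-d_s^0}+o(\lambda^{-d_r^0-d_s^0})$ as $\lambda\to0^+$. * **A2.** $\boldsymbol X_t-\mathbb E\boldsymbol X_t=\sum_{k\ge0}A_k\boldsymbol\varepsilon_{t-k}$ in mean square, with real $q\times q$ matrices $A_k$, $\sum_k\|A_k\|_\infty^2<\infty$, and a square integrable process $\{\boldsymbol\varepsilon_t\}_{t\in\mathbb Z}$ such that, with $\mathscr F_t=\sigma(\boldsymbol\varepsilon_s:s\le t)$, $\mathbb E(\boldsymbol\varepsilon_t\mid\mathscr F_{t-1})=0$ and $\mathbb E(\boldsymbol\varepsilon_t\boldsymbol\varepsilon_t'\mid\mathscr F_{t-1})=\mathrm I_q$ a.s. for all $t$; moreover there are a scalar random variable $\xi$ with $\mathbb E\xi^2<\infty$ and $K>0$ such that $\mathbb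 P(\|\boldsymbol\varepsilon_t\|_\infty^2>\eta)\le K\,\mathbb P(\xi^2>\eta)$ for all $t$ and all $\eta>0$. * **A3.** On some interval $(0,\delta)$ the series $A(\lambda)=\sum_{k\ge0}A_ke^{ik\lambda}$ converges to a differentiable function, and for every $r$ the $r$-th row of its conjugate transpose $A(\lambda)^*$ satisfies $\frac{\partial}{\partial\lambda}(A(\lambda)^*)_{r\cdot}=O\big(\lambda^{-1}\|(A(\lambda)^*)_{r\cdot}\|_\infty\big)$ as $\lambda\to0^+$. * **A4.** The positive integers $m=m(n)$ satisfy $\frac1m+\frac mn\to0$ as $n\to\infty$. Write $\lambda_j=2\pi j/n$. Let $\beta\in(0,1)$, let $B\subseteq\mathbb R^q$ be closed, and $$\Omega_\beta=\big[-\tfrac\beta2,0\big)^q\cap\big(-\tfrac12,0\big)^q\cap B .$$ Let $f_n$ be an $n^\beta$-consistent estimator of $f$, i.e. $n^\beta\max_{1\le j\le m}\|f_n(\lambda_j)-f(\lambda_j)\|_\infty\to0$ in probability (as holds in particular if $n^\beta\sup_\lambda\|f_n(\lambda)-f(\lambda)\|_\infty\to0$ in probability). Put $\Lambda_j(\boldsymbol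 d)=\operatorname{diag}_k\{\lambda_j^{-d_k}e^{i(\pi-\lambda_j)d_k/2}\}$ and $$\widehat G(\boldsymbol d)=\frac1m\sum_{j=1}^m\operatorname{Re}\big[\Lambda_j(\boldsymbol d)^{-1}f_n(\lambda_j)(\Lambda_j(\boldsymbol d)^{-1})^*\big],\qquad S(\boldsymbol d)=\log\det\widehat G(\boldsymbol d)-2\sum_{k=1}^qd_k\frac1m\sum_{j=1}^m\log\lambda_j .$$ Let $\widehat{\boldsymbol d}$ (depending on $n$) be a minimizer of $S$ over $\Omega_\beta$ whenever a minimizer exists, and arbitrary otherwise. **Theorem.** If $\boldsymbol d_0\in\Omega_\beta$, then $\widehat{\boldsymbol d}\to\boldsymbol d_0$ in probability as $n\to\infty$. -/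

import Mathlib

open MeasureTheory Filter Topology Set
open scoped ComplexOrder Matrix NNReal

noncomputable section

namespace GSE

variable {Ω : Type*} [MeasurableSpace Ω] {q : ℕ}

/-! ### Weakly stationary processes and fractional integration -/

/-- A `q`-dimensional (second order) weakly stationary process: square integrable, with constant
mean, and with autocovariances that depend on the lag only. -/
structure IsWeaklyStationary (P : Measure Ω) (X : ℤ → Ω → Fin q → ℝ) : Prop where
  memLp : ∀ t r, MemLp (fun ω => X t ω r) 2 P
  mean_eq : ∀ t r, ∫ ω, X t ω r ∂P = ∫ ω, X 0 ω r ∂P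
  cov_eq : ∀ t h r s,
    ProbabilityTheory.covariance (fun ω => X t ω r) (fun ω => X (t + h) ω s) P =
      ProbabilityTheory.covariance (fun ω => X 0 ω r) (fun ω => X h ω s) P

/-- `f` is (a version of) the spectral density matrix of `X`: it is integrable on `(-π, π]` and
`E[(X_t - E X_t)(X_{t+h} - E X_{t+h})ᵀ] = ∫_{-π}^{π} e^{ihx} f(x) dx` for all lags `h`. -/
structure IsSpectralDensity (P : Measure Ω) (X : ℤ → Ω → Fin q → ℝ)
    (f : ℝ → Matrix (Fin q) (Fin q) ℂ) : Prop where
  integrable : ∀ r s, IntegrableOn (fun x => f x r s) (Ioc (-Real.pi) Real.pi)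
  cov_eq : ∀ (t h : ℤ) (r s : Fin q),
    ((ProbabilityTheory.covariance (fun ω => X t ω r) (fun ω => X (t + h) ω s) P : ℝ) : ℂ) =
      ∫ x in (-Real.pi)..Real.pi, Complex.exp (Complex.I * h * x) * f x r s

/-- The coefficient of `z ^ j` in the binomial series of `(1 - z) ^ d`. -/
def fracCoeff (d : ℝ) (j : ℕ) : ℝ := (-1) ^ j * Ring.choose d j

/-- `X` is a weakly stationary solution of `diag_k {(1 - 𝓑)^{d_k}} (X_t - E X_t) = Y_t`, where
`d ∈ (-1/2, 1/2)^q`, `𝓑` is the backward shift, and `Y` is weakly stationary with spectral density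
matrix `fY` bounded and bounded away from zero (in the order of Hermitian matrices).
The series `(1 - 𝓑)^{d_k} = ∑ j, fracCoeff d_k j • 𝓑^j` converges in mean square. -/
structure IsFractionallyIntegrated (P : Measure Ω) (d : Fin q → ℝ) (X Y : ℤ → Ω → Fin q → ℝ)
    (fY : ℝ → Matrix (Fin q) (Fin q) ℂ) : Prop where
  d_mem : ∀ k, d k ∈ Ioo (-(1 / 2) : ℝ) (1 / 2)
  stationary : IsWeaklyStationary P X
  stationary_Y : IsWeaklyStationary P Y
  spectralDensity_Y : IsSpectralDensity P Y fY
  bounds : ∃ c C : ℝ, 0 < c ∧ ∀ᵐ x ∂(volume.restrict (Ioc (-Real.pi) Real.pi)),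
    (fY x - (c : ℂ) • (1 : Matrix (Fin q) (Fin q) ℂ)).PosSemidef ∧
    ((C : ℂ) • (1 : Matrix (Fin q) (Fin q) ℂ) - fY x).PosSemidef
  equation : ∀ (t : ℤ) (k : Fin q), Tendsto
    (fun N : ℕ => eLpNorm (fun ω =>
      (∑ j ∈ Finset.range N, fracCoeff (d k) j *
        (X (t - j) ω k - ∫ ω', X (t - j) ω' k ∂P)) - Y t ω k) 2 P)
    atTop (𝓝 0)

/-! ### The assumptions A1-A4 -/

/-- A1: `f_{rs}(x) = e^{iπ(d_r - d_s)/2} G_{rs} x^{-d_r-d_s} + o(x^{-d_r-d_s})` as `x → 0⁺`. -/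
def AssumptionA1 (f : ℝ → Matrix (Fin q) (Fin q) ℂ) (d : Fin q → ℝ)
    (G : Matrix (Fin q) (Fin q) ℝ) : Prop :=
  ∀ r s, (fun x : ℝ => f x r s -
      Complex.exp (Complex.I * Real.pi * (d r - d s) / 2) * (G r s : ℂ) *
        ((x ^ (-d r - d s) : ℝ) : ℂ))
    =o[𝓝[>] (0 : ℝ)] (fun x : ℝ => x ^ (-d r - d s))

/-- The sup-norm of a matrix, that is the largest modulus of its entries. -/
def supNorm {𝕜 : Type*} [NormedAddCommGroup 𝕜] (M : Matrix (Fin q) (Fin q) 𝕜) : ℝ≥0 :=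
  ‖Matrix.of.symm M‖₊

/-- A2: `X_t - E X_t = ∑_k A_k ε_{t-k}` (in mean square) with `∑_k ‖A_k‖_∞² < ∞`, where `ε` is a
square integrable martingale difference with conditional covariance the identity, with respect
to the filtration generated by `ε` itself, uniformly dominated in probability by a scalar random
variable with finite second moment. The norm on `Fin q → ℝ` is the sup-norm. -/
structure AssumptionA2 (P : Measure Ω) (X : ℤ → Ω → Fin q → ℝ)
    (A : ℕ → Matrix (Fin q) (Fin q) ℝ) (ε : ℤ → Ω → Fin q → ℝ) : Prop where
  summable : Summable (fun k => (supNorm (A k) : ℝ) ^ 2)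
  stronglyMeasurable : ∀ t, StronglyMeasurable (ε t)
  memLp : ∀ t r, MemLp (fun ω => ε t ω r) 2 P
  representation : ∀ (t : ℤ) (r : Fin q), Tendsto
    (fun N : ℕ => eLpNorm (fun ω =>
      (∑ k ∈ Finset.range N, (A k *ᵥ ε (t - k) ω) r) - (X t ω r - ∫ ω', X t ω' r ∂P)) 2 P)
    atTop (𝓝 0)
  condExp_eq_zero : ∀ t r,
    P[fun ω => ε t ω r | Filtration.natural ε stronglyMeasurable (t - 1)] =ᵐ[P] fun _ => 0
  condExp_mul : ∀ t r s,
    P[fun ω => ε t ω r * ε t ω s | Filtration.natural ε stronglyMeasurable (t - 1)]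
      =ᵐ[P] fun _ => (1 : Matrix (Fin q) (Fin q) ℝ) r s
  dominated : ∃ (ξ : Ω → ℝ) (K : ℝ), MemLp ξ 2 P ∧ 0 < K ∧ ∀ (t : ℤ) (η : ℝ), 0 < η →
    P {ω | η < ‖ε t ω‖ ^ 2} ≤ ENNReal.ofReal K * P {ω | η < ξ ω ^ 2}

/-- A3: on some interval `(0, δ)` the series `𝒜(x) = ∑_k A_k e^{ikx}` (which need not converge
absolutely) defines a differentiable function, and for every `r` the `r`-th row of the conjugate
transpose of `𝒜` satisfies `(d/dx) (𝒜(x)ᴴ)_{r·} = O(x⁻¹ ‖(𝒜(x)ᴴ)_{r·}‖_∞)` as `x → 0⁺`. -/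
def AssumptionA3 (A : ℕ → Matrix (Fin q) (Fin q) ℝ) : Prop :=
  ∃ (δ : ℝ) (𝒜 : ℝ → Matrix (Fin q) (Fin q) ℂ), 0 < δ ∧
    (∀ x ∈ Ioo 0 δ, ∀ r s, Tendsto
      (fun N : ℕ => ∑ k ∈ Finset.range N, (A k r s : ℂ) * Complex.exp (Complex.I * k * x))
      atTop (𝓝 (𝒜 x r s))) ∧
    (∀ x ∈ Ioo 0 δ, ∀ r s, DifferentiableAt ℝ (fun y => 𝒜 y r s) x) ∧
    ∀ r, (fun x : ℝ => deriv (fun y : ℝ => ((𝒜 y)ᴴ r : Fin q → ℂ)) x)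
      =O[𝓝[>] (0 : ℝ)] (fun x : ℝ => x⁻¹ * ‖((𝒜 x)ᴴ r : Fin q → ℂ)‖)

/-- A4: `1/m + m/n → 0` as `n → ∞`. Positivity of `m` is stated, as Lean has `1 / 0 = 0`. -/
def AssumptionA4 (m : ℕ → ℕ) : Prop :=
  (∀ᶠ n in atTop, 0 < m n) ∧
    Tendsto (fun n : ℕ => 1 / (m n : ℝ) + (m n : ℝ) / (n : ℝ)) atTop (𝓝 0)

/-! ### The estimator -/

/-- The Fourier frequency `2πj/n`. -/
def fourierFreq (n j : ℕ) : ℝ := 2 * Real.pi * j / n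

/-- The diagonal matrix with entries `x^{-d_k} e^{i(π-x)d_k/2}`. -/
def Lam (d : Fin q → ℝ) (x : ℝ) : Matrix (Fin q) (Fin q) ℂ :=
  Matrix.diagonal fun k =>
    ((x ^ (-d k) : ℝ) : ℂ) * Complex.exp (Complex.I * (Real.pi - x) * d k / 2)

/-- `Ĝ(d) = m⁻¹ ∑_{j=1}^m Re[Λ_j(d)⁻¹ g(λ_j) (Λ_j(d)⁻¹)ᴴ]`, for sample size `n`, bandwidth `m` and
estimated spectral density matrix `g`. -/
def Ghat (n m : ℕ) (g : ℝ → Matrix (Fin q) (Fin q) ℂ) (d : Fin q → ℝ) :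
    Matrix (Fin q) (Fin q) ℝ :=
  (1 / (m : ℝ)) • ∑ j ∈ Finset.Icc 1 m,
    ((Lam d (fourierFreq n j))⁻¹ * g (fourierFreq n j) *
      ((Lam d (fourierFreq n j))⁻¹)ᴴ).map Complex.re

/-- The objective function
`S(d) = log det Ĝ(d) - 2 ∑_k d_k m⁻¹ ∑_{j=1}^m log λ_j`. -/
def objective (n m : ℕ) (g : ℝ → Matrix (Fin q) (Fin q) ℂ) (d : Fin q → ℝ) : ℝ :=
  Real.log (Ghat n m g d).det -
    2 * ∑ k, d k * ((1 / (m : ℝ)) * ∑ j ∈ Finset.Icc 1 m, Real.log (fourierFreq n j))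

/-- The parameter set `Ω_β = [-β/2, 0)^q ∩ (-1/2, 0)^q ∩ B`. -/
def paramSet (β : ℝ) (B : Set (Fin q → ℝ)) : Set (Fin q → ℝ) :=
  {d | ∀ k, d k ∈ Ico (-β / 2) 0} ∩ {d | ∀ k, d k ∈ Ioo (-(1 / 2) : ℝ) 0} ∩ B

/-- `n^β (fhat n - f) → 0` in probability, in the sup-norm over the Fourier frequencies
`λ_1, …, λ_m`. (Convergence in the sup-norm over all frequencies implies this.) -/
def IsPowConsistent (P : Measure Ω) (β : ℝ) (m : ℕ → ℕ)
    (fhat : ℕ → Ω → ℝ → Matrix (Fin q) (Fin q) ℂ)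
    (f : ℝ → Matrix (Fin q) (Fin q) ℂ) : Prop :=
  TendstoInMeasure P
    (fun (n : ℕ) (ω : Ω) => (n : ℝ) ^ β *
      (((Finset.Icc 1 (m n)).sup fun j =>
        supNorm (fhat n ω (fourierFreq n j) - f (fourierFreq n j)) : ℝ≥0) : ℝ))
    atTop (fun _ => (0 : ℝ))

/-- `dhat` is a minimizer of `S` over `Θ` whenever `S` attains its minimum on `Θ`. (As `Θ` need not
be compact, a minimizer may fail to exist, and then the value of `dhat` is arbitrary.) -/
def IsArgmin (S : (Fin q → ℝ) → ℝ) (Θ : Set (Fin q → ℝ)) (dhat : Fin q → ℝ) : Prop :=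
  (∃ d ∈ Θ, IsMinOn S Θ d) → dhat ∈ Θ ∧ IsMinOn S Θ dhat

end GSE

end

/-! ### Oppenheim's inequality -/

namespace Matrix

/-! Put `θ = d - d₀` and scale `Ĝ(d)` on both sides by `λ_m^{-θ_k}`. By A1 and the consistency of
the spectral estimator, the result is uniformly close to `G ⊙ C`, where `C = corrMat m θ`
(`abs_normGhat_sub_le`). Consistency at rate `n^β` suffices because `d₀_k ≥ -β/2` gives `λ_j^{d₀_r +
d₀_s} ≤ n^β`, so the absolute error of the estimator stays small after multiplication by this power.

`C` is positive semidefinite with diagonal entries `powMean m (2θ_k)`, so Oppenheim's inequality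
gives `det (G ⊙ C) ≥ det G * ∏ powMean m (2θ_k)`, with equality at `θ = 0`. The powers of `λ_m`
cancel in the objective (`objective_sub`). Up to small errors, `S(d) - S(d₀)` is thus at least the
sum over `k` of `log (powMean m (2θ_k)) - 2θ_k * logMean m`. As `powMean m a` is at least about
`1/(1+a)` and `logMean m → -1`, each term is nearly at least `2θ_k - log (1 + 2θ_k) ≥ (2θ_k)²/9`.

On the parameter set `|2θ_k| ≤ β < 1`, so all these estimates are uniform in `d`
(`exists_objective_separation`). The separation also forces a minimizer to exist, although the
parameter set is not compact (`IsArgmin.abs_sub_lt`). -/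

theorem det_mul_prod_diag_le_det_hadamard_of_toBlocks₁₁ {m : Type*} [Fintype m] [DecidableEq m]
    {A B : Matrix (m ⊕ Unit) (m ⊕ Unit) ℝ} (hA : A.PosDef) (hB : B.PosSemidef)
    (ih : A.toBlocks₁₁.det * ∏ i, B.toBlocks₁₁ i i ≤ (A.toBlocks₁₁ ⊙ B.toBlocks₁₁).det) :
    A.det * ∏ i, B i i ≤ (A ⊙ B).det := by
  have hA11 : A.toBlocks₁₁.PosDef := hA.submatrix (e := Sum.inl) Sum.inl_injective
  have hprod : 0 ≤ ∏ i, B.toBlocks₁₁ i i := Finset.prod_nonneg fun i _ => hB.diag_nonneg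
  -- When the product vanishes, `A₁₁ ⊙ B₁₁` may be singular and the Schur complement formula used
  -- below is unavailable.
  rcases hprod.eq_or_lt with h0 | hpos
  · have h0' : ∏ i : m, B (Sum.inl i) (Sum.inl i) = 0 := h0.symm
    have : ∏ i, B i i = 0 := by rw [Fintype.prod_sum_type, h0', zero_mul]
    rw [this, mul_zero]
    exact (hA.posSemidef.hadamard hB).det_nonneg
  · have hH : 0 < (A.toBlocks₁₁ ⊙ B.toBlocks₁₁).det :=
      lt_of_lt_of_le (mul_pos hA11.det_pos hpos) ih
    let := A.toBlocks₁₁.invertibleOfIsUnitDet hA11.det_pos.ne'.isUnit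
    let := (A.toBlocks₁₁ ⊙ B.toBlocks₁₁).invertibleOfIsUnitDet hH.ne'.isUnit
    have hA12 : A.toBlocks₁₂ᴴ = A.toBlocks₂₁ := by
      ext i j
      exact hA.isHermitian.apply _ _
    set α := A.toBlocks₂₂ - A.toBlocks₂₁ * A.toBlocks₁₁⁻¹ * A.toBlocks₁₂ with hα
    have hAdet : A.det = A.toBlocks₁₁.det * α () () := by
      conv_lhs => rw [← fromBlocks_toBlocks A]
      rw [det_fromBlocks₁₁, invOf_eq_nonsing_inv, det_unique (n := Unit)]
    -- Subtracting the Schur complement `α` from the last corner makes `A` singular but keeps it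
    -- semidefinite. Its Hadamard product with `B` then has nonnegative determinant, which bounds
    -- the Schur complement of `A ⊙ B` below by `α` times the last diagonal entry of `B`.
    have hpsd : (fromBlocks A.toBlocks₁₁ A.toBlocks₁₂ A.toBlocks₁₂ᴴ
        (A.toBlocks₂₂ - α)).PosSemidef := by
      rw [PosDef.fromBlocks₁₁ _ _ hA11, hA12, hα, sub_sub_cancel, sub_self]
      exact PosSemidef.zero
    have hdet := (hpsd.hadamard hB).det_nonneg
    have e1 : fromBlocks A.toBlocks₁₁ A.toBlocks₁₂ A.toBlocks₁₂ᴴ (A.toBlocks₂₂ - α) ⊙ B =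
        fromBlocks (A.toBlocks₁₁ ⊙ B.toBlocks₁₁) (A.toBlocks₁₂ ⊙ B.toBlocks₁₂)
          (A.toBlocks₂₁ ⊙ B.toBlocks₂₁) ((A.toBlocks₂₂ - α) ⊙ B.toBlocks₂₂) := by
      rw [hA12]
      ext (i | i) (j | j) <;> rfl
    have e2 : A ⊙ B =
        fromBlocks (A.toBlocks₁₁ ⊙ B.toBlocks₁₁) (A.toBlocks₁₂ ⊙ B.toBlocks₁₂)
          (A.toBlocks₂₁ ⊙ B.toBlocks₂₁) (A.toBlocks₂₂ ⊙ B.toBlocks₂₂) := by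
      ext (i | i) (j | j) <;> rfl
    rw [e1, det_fromBlocks₁₁, det_unique (n := Unit)] at hdet
    rw [e2, det_fromBlocks₁₁, det_unique (n := Unit), hAdet, Fintype.prod_sum_type]
    have hα0 : 0 ≤ α () () := by
      have h := hA.det_pos
      rw [hAdet] at h
      exact (pos_of_mul_pos_right h hA11.det_pos.le).le
    have hb : 0 ≤ B (Sum.inr ()) (Sum.inr ()) := hB.diag_nonneg
    simp only [sub_apply, hadamard_apply, toBlocks₂₂, of_apply, toBlocks₁₁, Finset.univ_unique,
      Finset.prod_singleton, PUnit.default_eq_unit] at hdet ih ⊢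
    have := mul_le_mul_of_nonneg_right ih (mul_nonneg hα0 hb)
    nlinarith

/-- **Oppenheim's inequality**. -/
theorem PosDef.det_mul_prod_diag_le_det_hadamard {n : ℕ}
    {A B : Matrix (Fin n) (Fin n) ℝ} (hA : A.PosDef) (hB : B.PosSemidef) :
    A.det * ∏ i, B i i ≤ (A ⊙ B).det := by
  induction n with
  | zero => simp
  | succ n ih =>
    let e : Fin n ⊕ Unit ≃ Fin (n + 1) :=
      (Equiv.sumCongr (Equiv.refl _) (Equiv.ofUnique Unit (Fin 1))).trans finSumFinEquiv
    have h := det_mul_prod_diag_le_det_hadamard_of_toBlocks₁₁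
      (hA.submatrix e.injective) (hB.submatrix e)
      (ih (hA.submatrix (e.injective.comp Sum.inl_injective)) (hB.submatrix (e ∘ Sum.inl)))
    rw [← submatrix_hadamard, det_submatrix_equiv_self, det_submatrix_equiv_self] at h
    rwa [← e.prod_comp]

end Matrix

/-! ### Power means of `j / m` -/

namespace GSE

/-- The mean of `(j / m) ^ a` over `1 ≤ j ≤ m`. -/
noncomputable def powMean (m : ℕ) (a : ℝ) : ℝ :=
  (1 / (m : ℝ)) * ∑ j ∈ Finset.Icc 1 m, ((j : ℝ) / m) ^ a

theorem powMean_eq {m : ℕ} (hm : 0 < m) (a : ℝ) :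
    powMean m a = (∑ j ∈ Finset.Icc 1 m, (j : ℝ) ^ a) / (m : ℝ) ^ (1 + a) := by
  have hm' : (0 : ℝ) < m := by exact_mod_cast hm
  rw [powMean, Finset.mul_sum, Finset.sum_div]
  refine Finset.sum_congr rfl fun j _ => ?_
  rw [Real.div_rpow (by positivity) hm'.le, Real.rpow_add hm', Real.rpow_one]
  field_simp

/-- Bernoulli's inequality at `-1/(j+1)`: an increment of the concave function `x^(1+a)` dominates
its derivative at the right endpoint. -/
theorem rpow_one_add_sub_le_of_nonpos {a : ℝ} (ha : -1 < a) (ha' : a ≤ 0) (j : ℕ) :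
    ((j + 1 : ℕ) : ℝ) ^ (1 + a) - (j : ℝ) ^ (1 + a) ≥ (1 + a) * ((j + 1 : ℕ) : ℝ) ^ a := by
  have hj : (0 : ℝ) < ((j + 1 : ℕ) : ℝ) := by positivity
  have hs : -1 ≤ -(1 / ((j + 1 : ℕ) : ℝ)) := by
    rw [neg_le_neg_iff, div_le_one hj]; push_cast; linarith [(Nat.cast_nonneg j : (0 : ℝ) ≤ j)]
  have h := rpow_one_add_le_one_add_mul_self hs (p := 1 + a) (by linarith) (by linarith)
  have e : 1 + -(1 / ((j + 1 : ℕ) : ℝ)) = j / ((j + 1 : ℕ) : ℝ) := by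
    push_cast; field_simp; ring
  rw [e, Real.div_rpow (by positivity) hj.le, div_le_iff₀ (by positivity), Real.rpow_add hj,
    Real.rpow_one] at h
  rw [Real.rpow_add hj, Real.rpow_one]
  have e2 : (1 + (1 + a) * -(1 / ((j + 1 : ℕ) : ℝ))) * (((j + 1 : ℕ) : ℝ) *
      ((j + 1 : ℕ) : ℝ) ^ a) = ((j + 1 : ℕ) : ℝ) *
      ((j + 1 : ℕ) : ℝ) ^ a - (1 + a) * ((j + 1 : ℕ) : ℝ) ^ a := by
    field_simp; ring
  linarith

theorem rpow_one_add_sub_le_of_nonneg {a : ℝ} (ha : 0 ≤ a) (j : ℕ) :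
    ((j + 1 : ℕ) : ℝ) ^ (1 + a) - (j : ℝ) ^ (1 + a) ≤ (1 + a) * ((j + 1 : ℕ) : ℝ) ^ a := by
  have hj : (0 : ℝ) < ((j + 1 : ℕ) : ℝ) := by positivity
  have hs : -1 ≤ -(1 / ((j + 1 : ℕ) : ℝ)) := by
    rw [neg_le_neg_iff, div_le_one hj]; push_cast; linarith [(Nat.cast_nonneg j : (0 : ℝ) ≤ j)]
  have h := one_add_mul_self_le_rpow_one_add hs (p := 1 + a) (by linarith)
  have e : 1 + -(1 / ((j + 1 : ℕ) : ℝ)) = j / ((j + 1 : ℕ) : ℝ) := by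
    push_cast; field_simp; ring
  rw [e, Real.div_rpow (by positivity) hj.le, le_div_iff₀ (by positivity), Real.rpow_add hj,
    Real.rpow_one] at h
  rw [Real.rpow_add hj, Real.rpow_one]
  have e2 : (1 + (1 + a) * -(1 / ((j + 1 : ℕ) : ℝ))) * (((j + 1 : ℕ) : ℝ) *
      ((j + 1 : ℕ) : ℝ) ^ a) = ((j + 1 : ℕ) : ℝ) *
      ((j + 1 : ℕ) : ℝ) ^ a - (1 + a) * ((j + 1 : ℕ) : ℝ) ^ a := by
    field_simp; ring
  linarith

/-- Bernoulli's inequality at `1/j`, comparing with the derivative at the left endpoint; hence `j =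
0` is excluded. -/
theorem one_add_mul_rpow_le_of_nonpos {a : ℝ} (ha : -1 < a) (ha' : a ≤ 0) {j : ℕ} (hj : 0 < j) :
    ((j + 1 : ℕ) : ℝ) ^ (1 + a) - (j : ℝ) ^ (1 + a) ≤ (1 + a) * (j : ℝ) ^ a := by
  have hj' : (0 : ℝ) < j := by exact_mod_cast hj
  have h := rpow_one_add_le_one_add_mul_self (s := 1 / (j : ℝ)) (p := 1 + a)
    (by have : 0 < 1 / (j : ℝ) := by positivity
        linarith) (by linarith) (by linarith)
  have e : 1 + 1 / (j : ℝ) = ((j + 1 : ℕ) : ℝ) / j := by push_cast; field_simp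
  rw [e, Real.div_rpow (by positivity) hj'.le, div_le_iff₀ (by positivity)] at h
  rw [Real.rpow_add hj', Real.rpow_one] at h ⊢
  have e2 : (1 + (1 + a) * (1 / (j : ℝ))) * ((j : ℝ) * (j : ℝ) ^ a) =
      (j : ℝ) * (j : ℝ) ^ a + (1 + a) * (j : ℝ) ^ a := by field_simp
  linarith

theorem sum_rpow_le_of_nonpos {a : ℝ} (ha : -1 < a) (ha' : a ≤ 0) (m : ℕ) :
    (1 + a) * ∑ j ∈ Finset.Icc 1 m, (j : ℝ) ^ a ≤ (m : ℝ) ^ (1 + a) := by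
  induction m with
  | zero => simp [Real.zero_rpow (by linarith : 1 + a ≠ 0)]
  | succ m ih =>
    rw [Finset.sum_Icc_succ_top (by omega), mul_add]
    linarith [rpow_one_add_sub_le_of_nonpos ha ha' m]

theorem le_sum_rpow_of_nonneg {a : ℝ} (ha : 0 ≤ a) (m : ℕ) :
    (m : ℝ) ^ (1 + a) ≤ (1 + a) * ∑ j ∈ Finset.Icc 1 m, (j : ℝ) ^ a := by
  induction m with
  | zero => simp [Real.zero_rpow (by linarith : 1 + a ≠ 0)]
  | succ m ih =>
    rw [Finset.sum_Icc_succ_top (by omega), mul_add]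
    linarith [rpow_one_add_sub_le_of_nonneg ha m]

theorem le_sum_rpow_of_nonpos {a : ℝ} (ha : -1 < a) (ha' : a ≤ 0) (m : ℕ) :
    (m : ℝ) ^ (1 + a) - 1 ≤ (1 + a) * ∑ j ∈ Finset.Icc 1 m, (j : ℝ) ^ a := by
  -- The increments telescope from `1` to `m + 1`, which is where the loss of `1` comes from.
  have h : ((m + 1 : ℕ) : ℝ) ^ (1 + a) - 1 ≤ (1 + a) * ∑ j ∈ Finset.Icc 1 m, (j : ℝ) ^ a := by
    induction m with
    | zero => simp
    | succ m ih =>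
      rw [Finset.sum_Icc_succ_top (by omega), mul_add]
      linarith [one_add_mul_rpow_le_of_nonpos ha ha' m.succ_pos]
  have : (m : ℝ) ^ (1 + a) ≤ ((m + 1 : ℕ) : ℝ) ^ (1 + a) :=
    Real.rpow_le_rpow (by positivity) (by push_cast; linarith) (by linarith)
  linarith

theorem powMean_anti (m : ℕ) {a b : ℝ} (hab : a ≤ b) : powMean m b ≤ powMean m a := by
  unfold powMean
  refine mul_le_mul_of_nonneg_left (Finset.sum_le_sum fun j hj => ?_) (by positivity)
  rw [Finset.mem_Icc] at hj
  have h1 : (0 : ℝ) < j := by exact_mod_cast hj.1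
  have h2 : (0 : ℝ) < m := by exact_mod_cast hj.1.trans hj.2
  refine Real.rpow_le_rpow_of_exponent_ge (by positivity) ?_ hab
  rw [div_le_one h2]
  exact_mod_cast hj.2

theorem powMean_nonneg (m : ℕ) (a : ℝ) : 0 ≤ powMean m a := by unfold powMean; positivity

theorem powMean_le {m : ℕ} {a β : ℝ} (hβ0 : 0 ≤ β) (hβ : β < 1) (ha : -β ≤ a) :
    powMean m a ≤ 1 / (1 - β) := by
  refine (powMean_anti m ha).trans ?_
  rcases m.eq_zero_or_pos with rfl | hm
  · have : 0 < 1 - β := by linarith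
    simp [powMean]; linarith
  · have hm' : (0 : ℝ) < m := by exact_mod_cast hm
    rw [powMean_eq hm, div_le_div_iff₀ (by positivity) (by linarith), one_mul]
    have := sum_rpow_le_of_nonpos (a := -β) (by linarith) (by linarith) m
    linarith

/-- The limit is `∫₀¹ x^a dx = 1/(1+a)`. The point is that the relative error does not depend on
`a`: for `a ≤ 0` it is `m^{-(1+a)} ≤ m^{-(1-β)}`. -/
theorem le_powMean {m : ℕ} (hm : 0 < m) {a β : ℝ} (hβ : β < 1) (ha : -β ≤ a) :
    (1 - (m : ℝ) ^ (-(1 - β))) / (1 + a) ≤ powMean m a := by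
  have hm' : (0 : ℝ) < m := by exact_mod_cast hm
  have hm1 : (1 : ℝ) ≤ m := by exact_mod_cast hm
  rw [powMean_eq hm, div_le_div_iff₀ (by linarith) (by positivity), mul_comm (Finset.sum _ _)]
  rcases le_total 0 a with h | h
  · refine le_trans ?_ (le_sum_rpow_of_nonneg h m)
    refine mul_le_of_le_one_left (by positivity) ?_
    linarith [Real.rpow_nonneg hm'.le (-(1 - β))]
  · refine le_trans ?_ (le_sum_rpow_of_nonpos (by linarith) h m)
    rw [sub_mul, one_mul, ← Real.rpow_add hm']
    have := Real.one_le_rpow hm1 (z := -(1 - β) + (1 + a)) (by linarith)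
    linarith

theorem half_le_powMean {m : ℕ} (hm : 0 < m) {a : ℝ} (ha : a ≤ 1) : 1 / 2 ≤ powMean m a := by
  refine le_trans ?_ (powMean_anti m ha)
  have hm' : (0 : ℝ) < m := by exact_mod_cast hm
  have := le_sum_rpow_of_nonneg zero_le_one m
  rw [powMean_eq hm, div_le_div_iff₀ (by norm_num) (by positivity)]
  linarith

theorem powMean_zero {m : ℕ} (hm : 0 < m) : powMean m 0 = 1 := by
  have hm' : (m : ℝ) ≠ 0 := by exact_mod_cast hm.ne'
  simp [powMean, hm']

/-- The mean of `log (j / m)` over `1 ≤ j ≤ m`. -/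
noncomputable def logMean (m : ℕ) : ℝ :=
  (1 / (m : ℝ)) * ∑ j ∈ Finset.Icc 1 m, Real.log ((j : ℝ) / m)

theorem logMean_eq {m : ℕ} (hm : 0 < m) :
    logMean m = Real.log (m.factorial) / m - Real.log m := by
  have hm' : (m : ℝ) ≠ 0 := by exact_mod_cast hm.ne'
  have h : ∑ j ∈ Finset.Icc 1 m, Real.log ((j : ℝ) / m) =
      Real.log (m.factorial) - m * Real.log m := by
    have hfac : ∀ n : ℕ, ∑ j ∈ Finset.Icc 1 n, Real.log (j : ℝ) = Real.log n.factorial := by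
      intro n
      induction n with
      | zero => simp
      | succ n ih =>
        rw [Finset.sum_Icc_succ_top (by omega), ih, Nat.factorial_succ, Nat.cast_mul,
          Real.log_mul (by positivity) (by positivity), add_comm]
    have hcard : (m : ℝ) * Real.log m = ∑ j ∈ Finset.Icc 1 m, Real.log m := by simp
    rw [hcard, ← hfac, ← Finset.sum_sub_distrib]
    refine Finset.sum_congr rfl fun j hj => Real.log_div ?_ hm'
    exact_mod_cast (Nat.pos_of_ne_zero (by have := Finset.mem_Icc.1 hj; omega)).ne'
  rw [logMean, h]
  field_simp

/-- Stirling's formula for `log m!`; the limit is `∫₀¹ log x dx`. -/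
theorem tendsto_logMean : Tendsto logMean atTop (𝓝 (-1)) := by
  have h1 : Tendsto (fun n : ℕ => Real.log (Stirling.stirlingSeq n) / n) atTop (𝓝 0) := by
    have := (Real.continuousAt_log (Real.sqrt_pos.2 Real.pi_pos).ne').tendsto.comp
      Stirling.tendsto_stirlingSeq_sqrt_pi
    exact this.div_atTop tendsto_natCast_atTop_atTop
  have h2 : Tendsto (fun n : ℕ => Real.log n / n) atTop (𝓝 0) :=
    (Real.isLittleO_log_id_atTop.tendsto_div_nhds_zero).comp tendsto_natCast_atTop_atTop
  have h3 : Tendsto (fun n : ℕ => Real.log 2 / (n : ℝ)) atTop (𝓝 0) :=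
    tendsto_const_nhds.div_atTop tendsto_natCast_atTop_atTop
  have h := (h1.add ((h2.add h3).const_mul (1 / 2))).sub_const 1
  simp only [add_zero, mul_zero, zero_sub] at h
  refine h.congr' ?_
  filter_upwards [eventually_gt_atTop 0] with m hm
  have hm' : (m : ℝ) ≠ 0 := by exact_mod_cast hm.ne'
  rw [logMean_eq hm, Stirling.log_stirlingSeq_formula, Real.log_mul (by norm_num) hm',
    Real.log_div hm' (Real.exp_pos 1).ne', Real.log_exp]
  field_simp
  ring

/-- With `s = √(1+x)`, the bound `log s ≤ s - 1` gives `x - log (1+x) ≥ (s-1)²`. Since `x =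
(s-1)(s+1)` and `s + 1 ≤ 3`, this is at least `x²/9`. -/
theorem sq_div_nine_le_sub_log_one_add {x : ℝ} (hx : -1 < x) (hx' : x ≤ 1) :
    x ^ 2 / 9 ≤ x - Real.log (1 + x) := by
  set s := √(1 + x) with hs
  have hs0 : 0 < s := Real.sqrt_pos.2 (by linarith)
  have hs2 : s ^ 2 = 1 + x := Real.sq_sqrt (by linarith)
  have hs3 : s ≤ 2 := by nlinarith
  have hlog : Real.log (1 + x) = 2 * Real.log s := by rw [← hs2, Real.log_pow]; norm_num
  have h := Real.log_le_sub_one_of_pos hs0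
  have hx2 : x = s ^ 2 - 1 := by linarith
  rw [hlog]
  have : x ^ 2 / 9 ≤ (s - 1) ^ 2 := by
    rw [hx2]
    nlinarith [sq_nonneg (s - 1), mul_nonneg (sq_nonneg (s - 1)) (by nlinarith : 0 ≤ 9 - (s + 1) ^ 2)]
  nlinarith

end GSE

/-! ### The limit of the normalized matrix `Ĝ` -/

namespace GSE

variable {q : ℕ}

theorem inv_Lam {x : ℝ} (hx : 0 < x) (d : Fin q → ℝ) : (Lam d x)⁻¹ = Lam (-d) x := by
  refine Matrix.inv_eq_right_inv ?_
  rw [Lam, Lam, Matrix.diagonal_mul_diagonal, ← Matrix.diagonal_one]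
  congr 1
  funext k
  rw [mul_mul_mul_comm, ← Complex.ofReal_mul, ← Real.rpow_add hx, ← Complex.exp_add, Pi.neg_apply]
  have : Complex.I * (Real.pi - x) * d k / 2 + Complex.I * (Real.pi - x) * ((-d k : ℝ) : ℂ) / 2
      = 0 := by push_cast; ring
  rw [this]
  simp

theorem Lam_conj_re {x : ℝ} (hx : 0 < x) (d : Fin q → ℝ) (M : Matrix (Fin q) (Fin q) ℂ)
    (r s : Fin q) :
    (((Lam d x)⁻¹ * M * ((Lam d x)⁻¹)ᴴ).map Complex.re) r s = x ^ (d r + d s) *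
      (Complex.exp (Complex.I * (-((Real.pi - x) * (d r - d s) / 2) : ℝ)) * M r s).re := by
  rw [inv_Lam hx, Lam, Matrix.diagonal_conjTranspose, Matrix.map_apply, Matrix.mul_diagonal,
    Matrix.diagonal_mul, ← Complex.re_ofReal_mul]
  congr 1
  have hstar : star (fun k => (((x ^ (-(-d) k) : ℝ) : ℂ)) *
      Complex.exp (Complex.I * (Real.pi - x) * ((-d) k : ℝ) / 2)) s =
      (((x ^ (d s) : ℝ) : ℂ)) * Complex.exp (Complex.I * (((Real.pi - x) * d s / 2 : ℝ) : ℂ)) := by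
    simp only [Pi.star_apply, Pi.neg_apply, neg_neg, RCLike.star_def, map_mul, Complex.conj_ofReal,
      ← Complex.exp_conj]
    congr 2
    simp only [map_div₀, map_mul, Complex.conj_I, map_sub, Complex.conj_ofReal]
    push_cast
    have : (starRingEnd ℂ) 2 = 2 := Complex.conj_ofNat 2
    rw [this]
    ring
  rw [hstar, Real.rpow_add hx, Pi.neg_apply, neg_neg]
  have e : Complex.exp (Complex.I * (-((Real.pi - x) * (d r - d s) / 2) : ℝ)) =
      Complex.exp (Complex.I * (Real.pi - x) * ((-d r : ℝ) : ℂ) / 2) *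
        Complex.exp (Complex.I * (((Real.pi - x) * d s / 2 : ℝ) : ℂ)) := by
    rw [← Complex.exp_add]
    congr 1
    push_cast
    ring
  rw [e]
  push_cast
  ring

theorem Ghat_apply {n m : ℕ} (hn : 0 < n) (g : ℝ → Matrix (Fin q) (Fin q) ℂ) (d : Fin q → ℝ)
    (r s : Fin q) :
    Ghat n m g d r s = (1 / (m : ℝ)) * ∑ j ∈ Finset.Icc 1 m, fourierFreq n j ^ (d r + d s) *
      (Complex.exp (Complex.I * (-((Real.pi - fourierFreq n j) * (d r - d s) / 2) : ℝ)) *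
        g (fourierFreq n j) r s).re := by
  rw [Ghat, Matrix.smul_apply, Matrix.sum_apply, smul_eq_mul]
  congr 1
  refine Finset.sum_congr rfl fun j hj => Lam_conj_re ?_ d _ r s
  have h1 : (0 : ℝ) < j := by exact_mod_cast (Finset.mem_Icc.1 hj).1
  have h2 : (0 : ℝ) < n := by exact_mod_cast hn
  have := Real.pi_pos
  rw [fourierFreq]
  positivity

/-- Used with `a = d_r - d_s`, `b = d₀_r - d₀_s` and `w` the rescaled spectral entry. The last term
is the cost of replacing the phase `π - x` by `π`. -/
theorem abs_re_phase_sub_le (x a b G : ℝ) (w : ℂ) :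
    |(Complex.exp (Complex.I * (-((Real.pi - x) * a / 2) : ℝ)) * w).re -
        G * Real.cos (Real.pi * (a - b) / 2)| ≤
      ‖w - Complex.exp (Complex.I * (Real.pi * b / 2 : ℝ)) * G‖ + |G| * (|x| * |a| / 2) := by
  have hcos : G * Real.cos (Real.pi * (a - b) / 2) =
      (Complex.exp (Complex.I * (-(Real.pi * (a - b) / 2) : ℝ)) * G).re := by
    rw [mul_comm Complex.I, Complex.re_mul_ofReal, Complex.exp_ofReal_mul_I_re, Real.cos_neg,
      mul_comm]
  have e : Complex.exp (Complex.I * (-((Real.pi - x) * a / 2) : ℝ)) * w -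
      Complex.exp (Complex.I * (-(Real.pi * (a - b) / 2) : ℝ)) * G =
      Complex.exp (Complex.I * (-((Real.pi - x) * a / 2) : ℝ)) *
        (w - Complex.exp (Complex.I * (Real.pi * b / 2 : ℝ)) * G) +
      Complex.exp (Complex.I * (-(Real.pi * (a - b) / 2) : ℝ)) * G *
        (Complex.exp (Complex.I * (x * a / 2 : ℝ)) - 1) := by
    have e1 : Complex.exp (Complex.I * (-((Real.pi - x) * a / 2) : ℝ)) *
        Complex.exp (Complex.I * (Real.pi * b / 2 : ℝ)) =
        Complex.exp (Complex.I * (-(Real.pi * (a - b) / 2) : ℝ)) *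
        Complex.exp (Complex.I * (x * a / 2 : ℝ)) := by
      rw [← Complex.exp_add, ← Complex.exp_add]
      congr 1
      push_cast
      ring
    linear_combination (G : ℂ) * e1
  have hn : ∀ y : ℝ, ‖Complex.exp (Complex.I * y)‖ = 1 := fun y => by
    rw [mul_comm, Complex.norm_exp_ofReal_mul_I]
  rw [hcos, ← Complex.sub_re]
  refine (Complex.abs_re_le_norm _).trans ?_
  rw [e]
  refine (norm_add_le _ _).trans ?_
  rw [norm_mul, norm_mul, norm_mul, hn, hn, one_mul, one_mul, Complex.norm_real, Real.norm_eq_abs]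
  gcongr
  refine Real.norm_exp_I_mul_ofReal_sub_one_le.trans (le_of_eq ?_)
  rw [Real.norm_eq_abs, abs_div, abs_mul, abs_two]

/-- The matrix with entries `m⁻¹ ∑_j (j/m)^{θ_r + θ_s} cos (π (θ_r - θ_s) / 2)`. -/
noncomputable def corrMat (m : ℕ) (θ : Fin q → ℝ) : Matrix (Fin q) (Fin q) ℝ :=
  Matrix.of fun r s => powMean m (θ r + θ s) * Real.cos (Real.pi * (θ r - θ s) / 2)

/-- The matrix is an average over `j` of the real parts of the rank one matrices `z zᴴ` with `z_r =
(j/m)^{θ_r} e^{iπθ_r/2}`. -/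
theorem corrMat_posSemidef (m : ℕ) (θ : Fin q → ℝ) : (corrMat m θ).PosSemidef := by
  have h : corrMat m θ = ∑ j ∈ Finset.Icc 1 m, (1 / (m : ℝ)) •
      (Matrix.vecMulVec (fun r => ((j : ℝ) / m) ^ θ r * Real.cos (Real.pi * θ r / 2))
        (star fun r => ((j : ℝ) / m) ^ θ r * Real.cos (Real.pi * θ r / 2)) +
      Matrix.vecMulVec (fun r => ((j : ℝ) / m) ^ θ r * Real.sin (Real.pi * θ r / 2))
        (star fun r => ((j : ℝ) / m) ^ θ r * Real.sin (Real.pi * θ r / 2))) := by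
    ext r s
    rw [Matrix.sum_apply, corrMat, Matrix.of_apply, powMean, Finset.mul_sum, Finset.sum_mul]
    refine Finset.sum_congr rfl fun j hj => ?_
    have hj := Finset.mem_Icc.1 hj
    have h1 : (0 : ℝ) < j := by exact_mod_cast hj.1
    have h2 : (0 : ℝ) < m := by exact_mod_cast hj.1.trans hj.2
    have e : Real.pi * (θ r - θ s) / 2 = Real.pi * θ r / 2 - Real.pi * θ s / 2 := by ring
    rw [e, Real.cos_sub, Real.rpow_add (div_pos h1 h2)]
    simp only [Matrix.smul_apply, Matrix.add_apply, Matrix.vecMulVec_apply,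
      star_trivial, smul_eq_mul]
    ring
  rw [h]
  refine Matrix.posSemidef_sum _ fun j _ => Matrix.PosSemidef.smul ?_ (by positivity)
  exact (Matrix.posSemidef_vecMulVec_self_star _).add (Matrix.posSemidef_vecMulVec_self_star _)

theorem corrMat_diag (m : ℕ) (θ : Fin q → ℝ) (k : Fin q) :
    corrMat m θ k k = powMean m (2 * θ k) := by
  simp [corrMat, two_mul]

theorem corrMat_zero {m : ℕ} (hm : 0 < m) (r s : Fin q) : corrMat m (0 : Fin q → ℝ) r s = 1 := by
  simp [corrMat, powMean_zero hm]

theorem abs_corrMat_le (m : ℕ) (θ : Fin q → ℝ) (r s : Fin q) :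
    |corrMat m θ r s| ≤ powMean m (θ r + θ s) := by
  rw [corrMat, Matrix.of_apply, abs_mul, abs_of_nonneg (powMean_nonneg _ _)]
  exact mul_le_of_le_one_right (powMean_nonneg _ _) (Real.abs_cos_le_one _)

/-- `Ĝ(d)` normalized on both sides by `diag_k {λ_m^{-(d_k - d₀_k)}}`. -/
noncomputable def normGhat (n m : ℕ) (g : ℝ → Matrix (Fin q) (Fin q) ℂ) (d₀ d : Fin q → ℝ) :
    Matrix (Fin q) (Fin q) ℝ :=
  Matrix.diagonal (fun k => fourierFreq n m ^ (-(d k - d₀ k))) * Ghat n m g d *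
    Matrix.diagonal (fun k => fourierFreq n m ^ (-(d k - d₀ k)))

theorem normGhat_self (n m : ℕ) (g : ℝ → Matrix (Fin q) (Fin q) ℂ) (d₀ : Fin q → ℝ) :
    normGhat n m g d₀ d₀ = Ghat n m g d₀ := by
  simp [normGhat]

theorem det_normGhat (n m : ℕ) (g : ℝ → Matrix (Fin q) (Fin q) ℂ) (d₀ d : Fin q → ℝ) :
    (normGhat n m g d₀ d).det =
      (∏ k, fourierFreq n m ^ (-(d k - d₀ k))) ^ 2 * (Ghat n m g d).det := by
  rw [normGhat, Matrix.det_mul, Matrix.det_mul, Matrix.det_diagonal]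
  ring

theorem fourierFreq_eq_mul_div {n m j : ℕ} (hm : 0 < m) :
    fourierFreq n j = fourierFreq n m * ((j : ℝ) / m) := by
  have : (m : ℝ) ≠ 0 := by exact_mod_cast hm.ne'
  rw [fourierFreq, fourierFreq]
  field_simp

theorem fourierFreq_pos {n j : ℕ} (hn : 0 < n) (hj : 0 < j) : 0 < fourierFreq n j := by
  have := Real.pi_pos
  rw [fourierFreq]
  positivity

theorem fourierFreq_mono (n : ℕ) {j m : ℕ} (hj : j ≤ m) : fourierFreq n j ≤ fourierFreq n m := by
  have := Real.pi_pos
  rw [fourierFreq, fourierFreq]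
  gcongr

theorem abs_normGhat_sub_le {n m : ℕ} (hn : 0 < n) (hm : 0 < m)
    (g : ℝ → Matrix (Fin q) (Fin q) ℂ) (d₀ d : Fin q → ℝ) (G : Matrix (Fin q) (Fin q) ℝ) {δ : ℝ}
    (r s : Fin q) (hd : |d r - d s| ≤ 1) (hL : fourierFreq n m ≤ δ)
    (hg : ∀ j ∈ Finset.Icc 1 m,
      ‖((fourierFreq n j ^ (d₀ r + d₀ s) : ℝ) : ℂ) * g (fourierFreq n j) r s -
        Complex.exp (Complex.I * (Real.pi * (d₀ r - d₀ s) / 2 : ℝ)) * G r s‖ ≤ δ) :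
    |normGhat n m g d₀ d r s - (G ⊙ corrMat m (d - d₀)) r s| ≤
      powMean m ((d r - d₀ r) + (d s - d₀ s)) * ((1 + |G r s|) * δ) := by
  have hm' : (0 : ℝ) < m := by exact_mod_cast hm
  have hLp := fourierFreq_pos hn hm
  rw [normGhat, Matrix.mul_diagonal, Matrix.diagonal_mul, Ghat_apply hn, Matrix.hadamard_apply,
    corrMat, Matrix.of_apply, powMean, powMean]
  simp only [Pi.sub_apply]
  rw [mul_comm (G r s), mul_assoc (1 / (m : ℝ)), mul_left_comm, mul_assoc (1 / (m : ℝ)), mul_assoc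
    (1 / (m : ℝ)), mul_assoc (1 / (m : ℝ)), ← mul_sub, abs_mul,
    abs_of_pos (by positivity : 0 < 1 / (m : ℝ))]
  gcongr
  rw [Finset.mul_sum, Finset.sum_mul, Finset.sum_mul, Finset.sum_mul, Finset.sum_mul,
    ← Finset.sum_sub_distrib]
  refine (Finset.abs_sum_le_sum_abs _ _).trans (Finset.sum_le_sum fun j hj => ?_)
  have hj' := Finset.mem_Icc.1 hj
  have hjp : (0 : ℝ) < j := by exact_mod_cast hj'.1
  set x := fourierFreq n j with hx
  have hxp : 0 < x := fourierFreq_pos hn hj'.1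
  have hxδ : x ≤ δ := (fourierFreq_mono n hj'.2).trans hL
  set L := fourierFreq n m with hLdef
  have hu : 0 < (j : ℝ) / m := by positivity
  -- The normalization turns the excess power of `λ_j` into the weight `(j/m)^{θ_r+θ_s}`, leaving
  -- exactly the power that A1 compensates.
  have hpow : L ^ (-(d r - d₀ r)) * x ^ (d r + d s) * L ^ (-(d s - d₀ s)) =
      ((j : ℝ) / m) ^ (d r - d₀ r + (d s - d₀ s)) * x ^ (d₀ r + d₀ s) := by
    have e1 : d r + d s = (d r - d₀ r + (d s - d₀ s)) + (d₀ r + d₀ s) := by ring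
    have e2 : x ^ (d r - d₀ r + (d s - d₀ s)) =
        L ^ (d r - d₀ r) * L ^ (d s - d₀ s) * ((j : ℝ) / m) ^ (d r - d₀ r + (d s - d₀ s)) := by
      rw [hx, fourierFreq_eq_mul_div hm, Real.mul_rpow hLp.le hu.le, Real.rpow_add hLp]
    rw [e1, Real.rpow_add hxp, e2, Real.rpow_neg hLp.le, Real.rpow_neg hLp.le]
    have h1 := (Real.rpow_pos_of_pos hLp (d r - d₀ r)).ne'
    have h2 := (Real.rpow_pos_of_pos hLp (d s - d₀ s)).ne'
    field_simp
  have hphase := abs_re_phase_sub_le x (d r - d s) (d₀ r - d₀ s) (G r s)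
    (((x ^ (d₀ r + d₀ s) : ℝ) : ℂ) * g x r s)
  rw [mul_left_comm, Complex.re_ofReal_mul] at hphase
  have hcos : d r - d s - (d₀ r - d₀ s) = (d - d₀) r - (d - d₀) s := by
    simp only [Pi.sub_apply]; ring
  rw [hcos] at hphase
  simp only [Pi.sub_apply] at hphase
  set R := (Complex.exp (Complex.I * (-((Real.pi - x) * (d r - d s) / 2) : ℝ)) * g x r s).re
  set c := Real.cos (Real.pi * (d r - d₀ r - (d s - d₀ s)) / 2)
  have hkey : L ^ (-(d r - d₀ r)) * (x ^ (d r + d s) * R) * L ^ (-(d s - d₀ s)) -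
      ((j : ℝ) / m) ^ (d r - d₀ r + (d s - d₀ s)) * c * G r s =
      ((j : ℝ) / m) ^ (d r - d₀ r + (d s - d₀ s)) * (x ^ (d₀ r + d₀ s) * R - G r s * c) := by
    linear_combination R * hpow
  have hfin : |x ^ (d₀ r + d₀ s) * R - G r s * c| ≤ (1 + |G r s|) * δ := by
    refine hphase.trans ?_
    have h1 := hg j hj
    have h2 : |x| * |d r - d s| / 2 ≤ δ := by
      rw [abs_of_pos hxp]
      nlinarith [abs_nonneg (d r - d s)]
    nlinarith [mul_le_mul_of_nonneg_left h2 (abs_nonneg (G r s))]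
  have hfinal := mul_le_mul_of_nonneg_left hfin
    (Real.rpow_nonneg hu.le (d r - d₀ r + (d s - d₀ s)))
  convert hfinal using 1
  rw [← abs_of_nonneg (Real.rpow_nonneg hu.le (d r - d₀ r + (d s - d₀ s))), ← abs_mul,
    abs_of_nonneg (Real.rpow_nonneg hu.le (d r - d₀ r + (d s - d₀ s)))]
  rw [← hkey]

theorem exists_det_sub_lt (K : ℝ) {ε : ℝ} (hε : 0 < ε) :
    ∃ δ > 0, ∀ M N : Matrix (Fin q) (Fin q) ℝ, (∀ r s, |M r s| ≤ K) →
      (∀ r s, |N r s - M r s| ≤ δ) → |N.det - M.det| < ε := by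
  have hc : Continuous fun M : Fin q → Fin q → ℝ => (Matrix.of M).det :=
    Continuous.matrix_det continuous_id
  have hu := (isCompact_closedBall (0 : Fin q → Fin q → ℝ) (|K| + 1)).uniformContinuousOn_of_continuous
    hc.continuousOn
  obtain ⟨δ, hδ, h⟩ := Metric.uniformContinuousOn_iff.1 hu ε hε
  -- The `1` keeps `N` in the ball of radius `|K| + 1`; the half gives a strict inequality for the
  -- distance.
  refine ⟨min (δ / 2) 1, by positivity, fun M N hM hN => ?_⟩
  have hN' : ∀ r s, |N r s| ≤ |K| + 1 := fun r s => by
    have h1 := hM r s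
    have h2 := (hN r s).trans (min_le_right _ _)
    have h3 := abs_add_le (N r s - M r s) (M r s)
    rw [sub_add_cancel] at h3
    linarith [le_abs_self K]
  have hmem : ∀ A : Matrix (Fin q) (Fin q) ℝ, (∀ r s, |A r s| ≤ |K| + 1) →
      Matrix.of.symm A ∈ Metric.closedBall (0 : Fin q → Fin q → ℝ) (|K| + 1) := fun A hA => by
    rw [mem_closedBall_zero_iff]
    refine (pi_norm_le_iff_of_nonneg (by positivity)).2 fun r =>
      (pi_norm_le_iff_of_nonneg (by positivity)).2 fun s => hA r s
  have := h _ (hmem N hN') _ (hmem M fun r s => by linarith [hM r s, le_abs_self K]) ?_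
  · exact this
  · refine lt_of_le_of_lt ?_ (half_lt_self hδ)
    refine (dist_pi_le_iff (by positivity)).2 fun r => (dist_pi_le_iff (by positivity)).2 fun s => ?_
    rw [Real.dist_eq]
    exact (hN r s).trans (min_le_left _ _)

end GSE

/-! ### Separation of the objective function -/

namespace GSE

variable {q : ℕ}

/-- Writing `log λ_j = log λ_m + log (j/m)`, the `log λ_m` terms cancel against the scaling of the
determinant. -/
theorem objective_sub {n m : ℕ} (hn : 0 < n) (hm : 0 < m) (g : ℝ → Matrix (Fin q) (Fin q) ℂ)
    (d₀ d : Fin q → ℝ) (hd : 0 < (normGhat n m g d₀ d).det) :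
    objective n m g d - objective n m g d₀ =
      Real.log (normGhat n m g d₀ d).det - Real.log (normGhat n m g d₀ d₀).det -
        ∑ k, 2 * (d k - d₀ k) * logMean m := by
  have hL := fourierFreq_pos hn hm
  have hm' : (m : ℝ) ≠ 0 := by exact_mod_cast hm.ne'
  have hmean : (1 / (m : ℝ)) * ∑ j ∈ Finset.Icc 1 m, Real.log (fourierFreq n j) =
      Real.log (fourierFreq n m) + logMean m := by
    have h1 : ∑ j ∈ Finset.Icc 1 m, Real.log (fourierFreq n j) =
        m * Real.log (fourierFreq n m) + ∑ j ∈ Finset.Icc 1 m, Real.log ((j : ℝ) / m) := by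
      have hcard : (m : ℝ) * Real.log (fourierFreq n m) =
          ∑ j ∈ Finset.Icc 1 m, Real.log (fourierFreq n m) := by simp
      rw [hcard, ← Finset.sum_add_distrib]
      refine Finset.sum_congr rfl fun j hj => ?_
      have hjp : (0 : ℝ) < j := by exact_mod_cast (Finset.mem_Icc.1 hj).1
      rw [fourierFreq_eq_mul_div hm, Real.log_mul hL.ne' (by positivity)]
    rw [h1, logMean]
    field_simp
  have hprod : 0 < ∏ k, fourierFreq n m ^ (-(d k - d₀ k)) :=
    Finset.prod_pos fun k _ => Real.rpow_pos_of_pos hL _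
  have hdet : Real.log (normGhat n m g d₀ d).det =
      2 * ∑ k, (-(d k - d₀ k)) * Real.log (fourierFreq n m) + Real.log (Ghat n m g d).det := by
    have hG : (Ghat n m g d).det ≠ 0 := by
      intro h
      rw [det_normGhat, h, mul_zero] at hd
      exact lt_irrefl _ hd
    rw [det_normGhat, Real.log_mul (by positivity) hG, Real.log_pow,
      Real.log_prod fun k _ => (Real.rpow_pos_of_pos hL _).ne']
    simp only [Real.log_rpow hL]
    norm_num
  rw [hdet, normGhat_self, objective, objective, hmean]
  simp only [← Finset.sum_mul, ← Finset.mul_sum, Finset.sum_neg_distrib, Finset.sum_sub_distrib]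
  ring

theorem eventually_logMean_close {β : ℝ} (hβ : β < 1) {τ : ℝ} (hτ : 0 < τ) :
    ∀ᶠ m : ℕ in atTop, (m : ℝ) ^ (-(1 - β)) < 1 ∧
      |logMean m + 1| - Real.log (1 - (m : ℝ) ^ (-(1 - β))) ≤ τ := by
  have h1 : Tendsto (fun m : ℕ => (m : ℝ) ^ (-(1 - β))) atTop (𝓝 0) :=
    (tendsto_rpow_neg_atTop (by linarith)).comp tendsto_natCast_atTop_atTop
  have h2 : Tendsto (fun m : ℕ => Real.log (1 - (m : ℝ) ^ (-(1 - β)))) atTop (𝓝 0) := by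
    have := (h1.const_sub 1).log (by norm_num)
    simpa using this
  have h3 : Tendsto (fun m : ℕ => |logMean m + 1|) atTop (𝓝 0) := by
    have := (tendsto_logMean.add_const 1).abs
    simpa using this
  have h4 := h3.sub h2
  rw [sub_zero] at h4
  filter_upwards [h1.eventually (gt_mem_nhds one_pos), h4.eventually (gt_mem_nhds hτ)] with m a b
  exact ⟨a, b.le⟩

theorem log_powMean_sub_ge {m : ℕ} (hm : 0 < m) {β θ : ℝ} (hβ : β ∈ Ioo (0 : ℝ) 1)
    (hθ : |2 * θ| ≤ β) (hsmall : (m : ℝ) ^ (-(1 - β)) < 1) :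
    (2 * θ) ^ 2 / 9 - (|logMean m + 1| - Real.log (1 - (m : ℝ) ^ (-(1 - β)))) ≤
      Real.log (powMean m (2 * θ)) - 2 * θ * logMean m := by
  obtain ⟨h1, h2⟩ := abs_le.1 hθ
  have hpos : 0 < 1 + 2 * θ := by linarith [hβ.2]
  have h := le_powMean hm hβ.2 h1
  have hlog := Real.log_le_log (div_pos (sub_pos.2 hsmall) hpos) h
  rw [Real.log_div (sub_pos.2 hsmall).ne' hpos.ne'] at hlog
  have hsq := sq_div_nine_le_sub_log_one_add (x := 2 * θ) (by linarith) (by linarith [hβ.2])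
  have habs : 2 * θ * (logMean m + 1) ≤ |logMean m + 1| := by
    refine (le_abs_self _).trans ?_
    rw [abs_mul]
    exact mul_le_of_le_one_left (abs_nonneg _) (hθ.trans hβ.2.le)
  linarith

/-- If `g` is, uniformly over the first `m` Fourier frequencies, close to the leading term of the
spectral density, then `Ĝ` is nonsingular over the parameter set, and the objective function is
larger away from the true parameter than at it. -/
theorem exists_objective_separation (d₀ : Fin q → ℝ) {G : Matrix (Fin q) (Fin q) ℝ}
    (hG : G.PosDef) {β : ℝ} (hβ : β ∈ Ioo (0 : ℝ) 1) (hd₀ : ∀ k, d₀ k ∈ Ico (-β / 2) 0)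
    {η : ℝ} (hη : 0 < η) :
    ∃ δ > 0, ∀ᶠ m in atTop, ∀ n, 0 < n → fourierFreq n m ≤ δ →
      ∀ g : ℝ → Matrix (Fin q) (Fin q) ℂ,
      (∀ j ∈ Finset.Icc 1 m, ∀ r s,
        ‖((fourierFreq n j ^ (d₀ r + d₀ s) : ℝ) : ℂ) * g (fourierFreq n j) r s -
          Complex.exp (Complex.I * (Real.pi * (d₀ r - d₀ s) / 2 : ℝ)) * G r s‖ ≤ δ) →
      ∀ d : Fin q → ℝ, (∀ k, d k ∈ Ico (-β / 2) 0) →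
        (Ghat n m g d).det ≠ 0 ∧
          ((∃ k, η ≤ |d k - d₀ k|) → objective n m g d₀ < objective n m g d) := by
  have hD := hG.det_pos
  set D := G.det with hDdef
  have h1β : 0 < 1 - β := by linarith [hβ.2]
  -- Relative error of the determinants. It costs `2e` in the lower bound at `d` and `e` in the
  -- upper bound at `d₀`, together at most `η²/9`.
  set e := min (1 / 2) (η ^ 2 / 27) with he
  have he0 : 0 < e := by positivity
  have he1 : e ≤ 1 / 2 := min_le_left _ _
  have he2 : e ≤ η ^ 2 / 27 := min_le_right _ _
  set g0 := ∑ r, ∑ s, |G r s| with hg0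
  have hg0' : 0 ≤ g0 := by positivity
  have hGle : ∀ r s, |G r s| ≤ g0 := fun r s =>
    (Finset.single_le_sum (f := fun s => |G r s|) (fun _ _ => abs_nonneg _)
      (Finset.mem_univ s)).trans
    (Finset.single_le_sum (f := fun r => ∑ s, |G r s|)
      (fun _ _ => Finset.sum_nonneg fun _ _ => abs_nonneg _) (Finset.mem_univ r))
  -- Each diagonal power mean is at least `1/2`, so this tolerance is at most `e` times the
  -- Oppenheim lower bound.
  obtain ⟨δ₁, hδ₁, hdet⟩ := exists_det_sub_lt (q := q) (g0 * (1 / (1 - β)))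
    (ε := D * (1 / 2) ^ q * e) (by positivity)
  refine ⟨δ₁ * (1 - β) / (1 + g0), by positivity, ?_⟩
  set δ := δ₁ * (1 - β) / (1 + g0) with hδ
  have hδ0 : 0 < δ := by positivity
  filter_upwards [eventually_gt_atTop 0,
    -- Over `q` coordinates the loss is at most `η²/9`; the total loss `2η²/9` stays below the gain
    -- `4η²/9` from one bad coordinate.
    eventually_logMean_close hβ.2 (τ := η ^ 2 / (9 * (q + 1))) (by positivity)]
    with m hm hmean n hn hL g hg d hd
  have hθ : ∀ d : Fin q → ℝ, (∀ k, d k ∈ Ico (-β / 2) 0) → ∀ k, |2 * (d k - d₀ k)| ≤ β := by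
    intro d hd k
    rw [abs_le]
    constructor <;> linarith [(hd k).1, (hd k).2, (hd₀ k).1, (hd₀ k).2]
  have hclose : ∀ d : Fin q → ℝ, (∀ k, d k ∈ Ico (-β / 2) 0) →
      |(normGhat n m g d₀ d).det - (G ⊙ corrMat m (d - d₀)).det| < D * (1 / 2) ^ q * e := by
    intro d hd
    have hpm : ∀ r s, powMean m ((d r - d₀ r) + (d s - d₀ s)) ≤ 1 / (1 - β) := fun r s => by
      refine powMean_le hβ.1.le hβ.2 ?_
      linarith [(abs_le.1 (hθ d hd r)).1, (abs_le.1 (hθ d hd s)).1]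
    refine hdet _ _ (fun r s => ?_) fun r s => ?_
    · rw [Matrix.hadamard_apply, abs_mul]
      exact mul_le_mul (hGle r s) ((abs_corrMat_le _ _ _ _).trans (hpm r s)) (abs_nonneg _) hg0'
    · have hrs : |d r - d s| ≤ 1 := by
        rw [abs_le]
        constructor <;> linarith [(hd r).1, (hd r).2, (hd s).1, (hd s).2, hβ.2]
      refine (abs_normGhat_sub_le hn hm g d₀ d G r s hrs hL fun j hj => hg j hj r s).trans ?_
      calc powMean m ((d r - d₀ r) + (d s - d₀ s)) * ((1 + |G r s|) * δ)
          ≤ 1 / (1 - β) * ((1 + g0) * δ) := by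
            gcongr
            · exact hpm r s
            · exact hGle r s
        _ = δ₁ := by rw [hδ]; field_simp
  have hcd : ∀ k, 1 / 2 ≤ powMean m (2 * (d k - d₀ k)) := fun k =>
    half_le_powMean hm (by linarith [(abs_le.1 (hθ d hd k)).2, hβ.2])
  have hprod : (1 / 2 : ℝ) ^ q ≤ ∏ k, powMean m (2 * (d k - d₀ k)) := by
    have := Finset.prod_le_prod (s := (Finset.univ : Finset (Fin q))) (f := fun _ => (1 / 2 : ℝ))
      (fun _ _ => by norm_num) (fun k _ => hcd k)
    simpa using this
  have hprod0 : 0 < ∏ k, powMean m (2 * (d k - d₀ k)) := lt_of_lt_of_le (by positivity) hprod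
  have hopp := hG.det_mul_prod_diag_le_det_hadamard (corrMat_posSemidef m (d - d₀))
  simp only [corrMat_diag, Pi.sub_apply] at hopp
  have hlow : D * (∏ k, powMean m (2 * (d k - d₀ k))) * (1 - e) ≤ (normGhat n m g d₀ d).det := by
    have h1 := (abs_lt.1 (hclose d hd)).1
    have h2 := mul_le_mul_of_nonneg_right (mul_le_mul_of_nonneg_left hprod hD.le) he0.le
    linarith
  have hpos : 0 < (normGhat n m g d₀ d).det :=
    lt_of_lt_of_le (mul_pos (mul_pos hD hprod0) (by linarith)) hlow
  refine ⟨fun h => ?_, fun ⟨k₀, hk₀⟩ => ?_⟩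
  · rw [det_normGhat, h, mul_zero] at hpos
    exact lt_irrefl _ hpos
  have hG₀ : G ⊙ corrMat m (d₀ - d₀) = G := by
    ext r s
    rw [Matrix.hadamard_apply, sub_self, corrMat_zero hm, mul_one]
  have hup : (normGhat n m g d₀ d₀).det ≤ D * (1 + e) := by
    have h1 := (abs_lt.1 (hclose d₀ hd₀)).2
    rw [hG₀] at h1
    have h3 : D * (1 / 2) ^ q * e ≤ D * 1 * e := by
      gcongr
      exact pow_le_one₀ (by norm_num) (by norm_num)
    linarith
  have hpos₀ : 0 < (normGhat n m g d₀ d₀).det := by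
    have h1 := (abs_lt.1 (hclose d₀ hd₀)).1
    rw [hG₀] at h1
    have h3 : D * (1 / 2) ^ q * e ≤ D * 1 * (1 / 2) := by
      gcongr
      exact pow_le_one₀ (by norm_num) (by norm_num)
    linarith
  rw [← sub_pos, objective_sub hn hm g d₀ d hpos]
  have hlog1 : Real.log D + ∑ k, Real.log (powMean m (2 * (d k - d₀ k))) - 2 * e ≤
      Real.log (normGhat n m g d₀ d).det := by
    have h := Real.log_le_log (mul_pos (mul_pos hD hprod0) (by linarith)) hlow
    rw [Real.log_mul (by positivity) (by linarith), Real.log_mul hD.ne' hprod0.ne',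
      Real.log_prod fun k _ => (lt_of_lt_of_le (by norm_num) (hcd k)).ne'] at h
    have h2 := Real.one_sub_inv_le_log_of_pos (show 0 < 1 - e by linarith)
    have h3 : (1 - e)⁻¹ ≤ 1 + 2 * e := by
      rw [inv_le_iff_one_le_mul₀ (by linarith)]
      nlinarith
    linarith
  have hlog2 : Real.log (normGhat n m g d₀ d₀).det ≤ Real.log D + e := by
    have h := Real.log_le_log hpos₀ hup
    rw [Real.log_mul hD.ne' (by linarith)] at h
    linarith [Real.log_le_sub_one_of_pos (show 0 < 1 + e by linarith)]
  set τ := |logMean m + 1| - Real.log (1 - (m : ℝ) ^ (-(1 - β)))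
  have hsum : ∑ k, ((2 * (d k - d₀ k)) ^ 2 / 9 - τ) ≤
      ∑ k, (Real.log (powMean m (2 * (d k - d₀ k))) - 2 * (d k - d₀ k) * logMean m) :=
    Finset.sum_le_sum fun k _ => log_powMean_sub_ge hm hβ (hθ d hd k) hmean.1
  clear_value τ
  rw [Finset.sum_sub_distrib, Finset.sum_sub_distrib] at hsum
  have hτ : ∑ _k : Fin q, τ ≤ η ^ 2 / 9 := by
    rw [Finset.sum_const, Finset.card_univ, Fintype.card_fin, nsmul_eq_mul]
    calc (q : ℝ) * τ ≤ q * (η ^ 2 / (9 * (q + 1))) := by gcongr; exact hmean.2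
      _ ≤ (q + 1) * (η ^ 2 / (9 * (q + 1))) := by gcongr; linarith
      _ = η ^ 2 / 9 := by field_simp
  have hsq : (2 * η) ^ 2 / 9 ≤ ∑ k, (2 * (d k - d₀ k)) ^ 2 / 9 := by
    refine le_trans ?_ (Finset.single_le_sum (f := fun k => (2 * (d k - d₀ k)) ^ 2 / 9)
      (fun _ _ => by positivity) (Finset.mem_univ k₀))
    have := pow_le_pow_left₀ hη.le hk₀ 2
    rw [sq_abs] at this
    simp only [mul_pow]
    linarith
  have : 0 < η ^ 2 := by positivity
  linarith

end GSE

/-! ### Existence of minimizers and consistency -/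

namespace GSE

variable {q : ℕ}

theorem continuous_Ghat {n : ℕ} (hn : 0 < n) (m : ℕ) (g : ℝ → Matrix (Fin q) (Fin q) ℂ) :
    Continuous (Ghat n m g) := by
  refine continuous_matrix fun r s => ?_
  simp only [Ghat_apply hn]
  refine continuous_const.mul (continuous_finsetSum _ fun j hj => ?_)
  have hx := fourierFreq_pos hn (Finset.mem_Icc.1 hj).1
  refine Continuous.mul ?_ (Complex.continuous_re.comp ?_)
  · exact continuous_const.rpow (by fun_prop) fun _ => Or.inl hx.ne'
  · fun_prop

/-- A minimizer over the parameter set exists and is close to `d₀`, provided that the objective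
function is larger than at `d₀` outside a neighbourhood of `d₀` on which `Ĝ` is nonsingular. -/
theorem IsArgmin.abs_sub_lt {n m : ℕ} (hn : 0 < n) {g : ℝ → Matrix (Fin q) (Fin q) ℂ}
    {β η : ℝ} (hη : 0 < η) (hβ : β ∈ Ioo (0 : ℝ) 1) {B : Set (Fin q → ℝ)} (hB : IsClosed B)
    {d₀ dhat : Fin q → ℝ} (hd₀ : d₀ ∈ paramSet β B) (hη' : ∀ k, d₀ k + η < 0)
    (hS : ∀ d : Fin q → ℝ, (∀ k, d k ∈ Ico (-β / 2) 0) →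
      (Ghat n m g d).det ≠ 0 ∧
        ((∃ k, η ≤ |d k - d₀ k|) → objective n m g d₀ < objective n m g d))
    (hdhat : IsArgmin (objective n m g) (paramSet β B) dhat) (k : Fin q) :
    |dhat k - d₀ k| < η := by
  -- The box stops at `d₀_k + η < 0`, away from the open face of the parameter set, so `K` is
  -- compact. Parameters outside `K` have a coordinate at distance at least `η` and are beaten by
  -- `d₀`.
  set K : Set (Fin q → ℝ) :=
    (Set.univ.pi fun k => Icc (max (-β / 2) (d₀ k - η)) (d₀ k + η)) ∩ B with hK
  have hKc : IsCompact K := (isCompact_univ_pi fun k => isCompact_Icc).inter_right hB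
  have hbox : ∀ d ∈ K, ∀ k, d k ∈ Ico (-β / 2) 0 := fun d hd k => by
    have h := hd.1 k (mem_univ k)
    exact ⟨(le_max_left _ _).trans h.1, h.2.trans_lt (hη' k)⟩
  have hKsub : K ⊆ paramSet β B := fun d hd =>
    ⟨⟨hbox d hd, fun k => ⟨by linarith [(hbox d hd k).1, hβ.2], (hbox d hd k).2⟩⟩, hd.2⟩
  have hd₀K : d₀ ∈ K := ⟨fun k _ => ⟨max_le (hd₀.1.1 k).1 (by linarith), by linarith⟩, hd₀.2⟩
  have hcont : ContinuousOn (objective n m g) K := by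
    unfold objective
    refine ContinuousOn.sub (ContinuousOn.log ?_ fun d hd => (hS d (hbox d hd)).1) ?_
    · exact (continuous_Ghat hn m g).matrix_det.continuousOn
    · fun_prop
  obtain ⟨d₁, hd₁, hmin⟩ := hKc.exists_isMinOn ⟨d₀, hd₀K⟩ hcont
  have hex : IsMinOn (objective n m g) (paramSet β B) d₁ := fun d hd => by
    by_cases hdK : d ∈ K
    · exact hmin hdK
    · refine (hmin hd₀K).trans ((hS d hd.1.1).2 ?_).le
      by_contra! hlt
      refine hdK ⟨fun k _ => ?_, hd.2⟩
      have := abs_lt.1 (hlt k)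
      exact ⟨max_le (hd.1.1 k).1 (by linarith), by linarith⟩
  obtain ⟨hmem, hmin'⟩ := hdhat ⟨d₁, hKsub hd₁, hex⟩
  by_contra! hge
  exact absurd (hmin' hd₀) (not_le.2 ((hS dhat hmem.1.1).2 ⟨k, hge⟩))

/-! ### Consequences of A1 and A4 at the Fourier frequencies -/

theorem AssumptionA4.tendsto_atTop {m : ℕ → ℕ} (h : AssumptionA4 m) : Tendsto m atTop atTop := by
  rw [← tendsto_natCast_atTop_iff (R := ℝ)]
  have h1 : Tendsto (fun n => 1 / (m n : ℝ)) atTop (𝓝 0) :=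
    squeeze_zero (fun n => by positivity)
      (fun n => le_add_of_nonneg_right (by positivity)) h.2
  have h2 : Tendsto (fun n => 1 / (m n : ℝ)) atTop (𝓝[>] 0) :=
    tendsto_nhdsWithin_iff.2 ⟨h1, h.1.mono fun n hn => by
      have : (0 : ℝ) < m n := by exact_mod_cast hn
      exact one_div_pos.2 this⟩
  exact h2.inv_tendsto_nhdsGT_zero.congr fun n => by simp

theorem AssumptionA4.tendsto_fourierFreq {m : ℕ → ℕ} (h : AssumptionA4 m) :
    Tendsto (fun n => fourierFreq n (m n)) atTop (𝓝 0) := by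
  have h1 : Tendsto (fun n : ℕ => (m n : ℝ) / n) atTop (𝓝 0) :=
    squeeze_zero (fun n => by positivity)
      (fun n => le_add_of_nonneg_left (by positivity)) h.2
  have h2 := h1.const_mul (2 * Real.pi)
  rw [mul_zero] at h2
  refine h2.congr fun n => ?_
  rw [fourierFreq]
  ring

theorem norm_apply_le_supNorm (M : Matrix (Fin q) (Fin q) ℂ) (r s : Fin q) :
    ‖M r s‖ ≤ supNorm M :=
  (norm_le_pi_norm (Matrix.of.symm M r) s).trans (norm_le_pi_norm (Matrix.of.symm M) r)

theorem AssumptionA1.eventually_norm_sub_le {f : ℝ → Matrix (Fin q) (Fin q) ℂ} {d : Fin q → ℝ}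
    {G : Matrix (Fin q) (Fin q) ℝ} (h : AssumptionA1 f d G) {δ : ℝ} (hδ : 0 < δ) :
    ∀ᶠ x in 𝓝[>] (0 : ℝ), ∀ r s, ‖((x ^ (d r + d s) : ℝ) : ℂ) * f x r s -
      Complex.exp (Complex.I * (Real.pi * (d r - d s) / 2 : ℝ)) * G r s‖ ≤ δ := by
  refine eventually_all.2 fun r => eventually_all.2 fun s => ?_
  filter_upwards [(h r s).bound hδ, self_mem_nhdsWithin] with x hx hx0
  have hx0 : 0 < x := hx0
  have hp : 0 < x ^ (d r + d s) := Real.rpow_pos_of_pos hx0 _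
  have hinv : x ^ (d r + d s) * x ^ (-d r - d s) = 1 := by
    rw [← Real.rpow_add hx0]
    simp
  have hinv' : ((x ^ (d r + d s) : ℝ) : ℂ) * ((x ^ (-d r - d s) : ℝ) : ℂ) = 1 := by
    rw [← Complex.ofReal_mul, hinv, Complex.ofReal_one]
  have e : ((x ^ (d r + d s) : ℝ) : ℂ) * f x r s -
      Complex.exp (Complex.I * (Real.pi * (d r - d s) / 2 : ℝ)) * G r s =
      ((x ^ (d r + d s) : ℝ) : ℂ) * (f x r s -
        Complex.exp (Complex.I * Real.pi * (d r - d s) / 2) * (G r s : ℂ) *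
        ((x ^ (-d r - d s) : ℝ) : ℂ)) := by
    have : Complex.I * (Real.pi * (d r - d s) / 2 : ℝ) =
      Complex.I * Real.pi * (d r - d s) / 2 := by push_cast; ring
    rw [this]
    linear_combination
      (Complex.exp (Complex.I * Real.pi * (d r - d s) / 2) * (G r s : ℂ)) * hinv'
  rw [e, norm_mul, Complex.norm_real, Real.norm_of_nonneg hp.le]
  rw [Real.norm_of_nonneg (Real.rpow_nonneg hx0.le _)] at hx
  calc x ^ (d r + d s) * _ ≤ x ^ (d r + d s) * (δ * x ^ (-d r - d s)) := by gcongr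
    _ = δ := by rw [mul_left_comm, hinv, mul_one]

/-- At Fourier frequencies in `(0, 1]` the function `x ^ a`, `a ≥ -β`, is at most `n ^ β`. -/
theorem fourierFreq_rpow_le {n j : ℕ} (hn : 0 < n) (hj : 0 < j) (hx1 : fourierFreq n j ≤ 1)
    {a β : ℝ} (hβ : 0 ≤ β) (ha : -β ≤ a) : fourierFreq n j ^ a ≤ (n : ℝ) ^ β := by
  have hn' : (0 : ℝ) < n := by exact_mod_cast hn
  have hj' : (1 : ℝ) ≤ j := by exact_mod_cast hj
  have hx := fourierFreq_pos hn hj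
  calc fourierFreq n j ^ a ≤ fourierFreq n j ^ (-β) :=
        Real.rpow_le_rpow_of_exponent_ge hx hx1 ha
    _ ≤ (1 / (n : ℝ)) ^ (-β) := by
        refine Real.rpow_le_rpow_of_nonpos (by positivity) ?_ (by linarith)
        rw [fourierFreq]
        gcongr
        nlinarith [Real.pi_gt_three]
    _ = (n : ℝ) ^ β := by rw [Real.rpow_neg (by positivity), one_div, Real.inv_rpow hn'.le, inv_inv]

end GSE

theorem theorem3p1 {Ω : Type*} [MeasurableSpace Ω] (P : Measure Ω) [IsProbabilityMeasure P]
    {q : ℕ}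
    -- the process, its spectral density matrix and the true parameters
    (d₀ : Fin q → ℝ) (X Y : ℤ → Ω → Fin q → ℝ)
    (f fY : ℝ → Matrix (Fin q) (Fin q) ℂ) (G₀ : Matrix (Fin q) (Fin q) ℝ)
    (hX : GSE.IsFractionallyIntegrated P d₀ X Y fY)
    (hf : GSE.IsSpectralDensity P X f)
    (hG₀ : G₀.PosDef)
    (hfY : ∀ r s, Tendsto (fun x => fY x r s) (𝓝[>] (0 : ℝ)) (𝓝 ((G₀ r s : ℝ) : ℂ)))
    -- the assumptions A1-A4
    (A : ℕ → Matrix (Fin q) (Fin q) ℝ) (ε : ℤ → Ω → Fin q → ℝ) (m : ℕ → ℕ)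
    (hA1 : GSE.AssumptionA1 f d₀ G₀)
    (hA2 : GSE.AssumptionA2 P X A ε)
    (hA3 : GSE.AssumptionA3 A)
    (hA4 : GSE.AssumptionA4 m)
    -- the estimator of the spectral density matrix
    (β : ℝ) (hβ : β ∈ Ioo (0 : ℝ) 1) (B : Set (Fin q → ℝ)) (hB : IsClosed B)
    (fhat : ℕ → Ω → ℝ → Matrix (Fin q) (Fin q) ℂ)
    (hfhat : GSE.IsPowConsistent P β m fhat f)
    (hd₀ : d₀ ∈ GSE.paramSet β B)
    -- the estimator of the parameter
    (dhat : ℕ → Ω → Fin q → ℝ)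
    (hdhat : ∀ n ω,
      GSE.IsArgmin (GSE.objective n (m n) (fhat n ω)) (GSE.paramSet β B) (dhat n ω)) :
    TendstoInMeasure P dhat atTop (fun _ => d₀) := by
  rw [tendstoInMeasure_iff_dist]
  intro ρ hρ
  obtain ⟨η, hη, hηρ, hηd⟩ : ∃ η > 0, η ≤ ρ ∧ ∀ k, d₀ k + η < 0 := by
    have h1 : ∀ᶠ η in 𝓝[>] (0 : ℝ), ∀ k, d₀ k + η < 0 := by
      refine eventually_all.2 fun k => ?_
      filter_upwards [Ioo_mem_nhdsGT (show 0 < -d₀ k by linarith [(hd₀.1.1 k).2])] with η h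
      linarith [h.2]
    obtain ⟨η, h, h'⟩ := (h1.and (Ioc_mem_nhdsGT hρ)).exists
    exact ⟨η, h'.1, h'.2, h⟩
  obtain ⟨δ, hδ, hsep⟩ := GSE.exists_objective_separation d₀ hG₀ hβ hd₀.1.1 hη
  have hfhat' := tendstoInMeasure_iff_dist.1 hfhat (δ / 2) (half_pos hδ)
  -- For large `n` the event that `dhat` is at least `ρ` away lies inside the event that the scaled
  -- spectral error is at least `δ / 2`. The other half of `δ` is left for the remainder in A1.
  refine tendsto_of_tendsto_of_tendsto_of_le_of_le' tendsto_const_nhds hfhat'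
    (Eventually.of_forall fun _ => zero_le) ?_
  obtain ⟨x₀, hx₀, hA1'⟩ := mem_nhdsGT_iff_exists_Ioo_subset.1
    (hA1.eventually_norm_sub_le (half_pos hδ))
  filter_upwards [eventually_gt_atTop 0, hA4.1, hA4.tendsto_atTop.eventually hsep,
    hA4.tendsto_fourierFreq.eventually (gt_mem_nhds (lt_min (lt_min hδ hx₀) one_pos))]
    with n hn hm hsepn hfreq
  refine measure_mono fun ω hω => ?_
  rw [lt_min_iff, lt_min_iff] at hfreq
  by_contra hlt
  rw [mem_ofPred_eq, not_le, Real.dist_eq, sub_zero, abs_of_nonneg (by positivity)] at hlt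
  refine absurd hω (not_le.2 (lt_of_lt_of_le ?_ hηρ))
  refine (dist_pi_lt_iff hη).2 fun k => ?_
  rw [Real.dist_eq]
  refine GSE.IsArgmin.abs_sub_lt hn hη hβ hB hd₀ hηd ?_ (hdhat n ω) k
  refine hsepn n hn hfreq.1.1.le (fhat n ω) fun j hj r s => ?_
  have hj' := Finset.mem_Icc.1 hj
  have hxp := GSE.fourierFreq_pos hn hj'.1
  have hxle := GSE.fourierFreq_mono n hj'.2
  -- Here `d₀_r + d₀_s ≥ -β` matches the rate of consistency.
  have hpow : GSE.fourierFreq n j ^ (d₀ r + d₀ s) ≤ (n : ℝ) ^ β :=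
    GSE.fourierFreq_rpow_le hn hj'.1 (hxle.trans hfreq.2.le) hβ.1.le
      (by linarith [(hd₀.1.1 r).1, (hd₀.1.1 s).1])
  have h1 := hA1' ⟨hxp, hxle.trans_lt hfreq.1.2⟩ r s
  have h2 : ‖fhat n ω (GSE.fourierFreq n j) r s - f (GSE.fourierFreq n j) r s‖ ≤
      ((Finset.Icc 1 (m n)).sup fun j => GSE.supNorm
        (fhat n ω (GSE.fourierFreq n j) - f (GSE.fourierFreq n j)) : ℝ≥0) := by
    refine (GSE.norm_apply_le_supNorm
      (fhat n ω (GSE.fourierFreq n j) - f (GSE.fourierFreq n j)) r s).trans ?_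
    exact_mod_cast Finset.le_sup (f := fun j => GSE.supNorm
      (fhat n ω (GSE.fourierFreq n j) - f (GSE.fourierFreq n j))) hj
  have h3 : ‖((GSE.fourierFreq n j ^ (d₀ r + d₀ s) : ℝ) : ℂ) *
      (fhat n ω (GSE.fourierFreq n j) r s - f (GSE.fourierFreq n j) r s)‖ ≤ δ / 2 := by
    rw [norm_mul, Complex.norm_real, Real.norm_of_nonneg (Real.rpow_nonneg hxp.le _)]
    exact (mul_le_mul hpow h2 (norm_nonneg _) (by positivity)).trans hlt.le
  calc _ = ‖((GSE.fourierFreq n j ^ (d₀ r + d₀ s) : ℝ) : ℂ) *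
        (fhat n ω (GSE.fourierFreq n j) r s - f (GSE.fourierFreq n j) r s) +
        (((GSE.fourierFreq n j ^ (d₀ r + d₀ s) : ℝ) : ℂ) * f (GSE.fourierFreq n j) r s -
          Complex.exp (Complex.I * (Real.pi * (d₀ r - d₀ s) / 2 : ℝ)) * G₀ r s)‖ := by
        congr 1; ring
    _ ≤ δ / 2 + δ / 2 := (norm_add_le _ _).trans (add_le_add h3 h1)
    _ = δ := add_halves δ
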